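/- **Lemma (learning a string).** Logarithms are to base 2, and $K(x\mid y)$ denotes the conditional prefix Kolmogorov complexity of $x$ given $y$, i.e. the length in bits of a shortest program from which a fixed additively optimal prefix machine computes $x$ when given $y$. Let $\Sigma$ be a finite alphabet. There is a constant $c$, depending only on $\Sigma$ and on the optimal prefix machine that defines $K$, such that the following holds for all integers $s,n\ge 1$. Let $t\in\Sigma^*$ be a string of length $s$ (the target), let $S$ be a finite set of substrings of $t$, each of length $n$ (the examples), and let $t'$ be a common superstring returned by Greedy on $S$: starting from $S$, Greedy repeatedly chooses an ordered pair of distinct strings $u,v$ in the current set whose overlap (the longest suffix of $u$ that is a prefix of $v$) has maximum length, ties being broken arbitrarily, and replaces $u$ and $v$ by the string obtained from $uv$ by identifying the two copies of that overlap, until a single string is left. If $t'$ has length at most $2s$, then $$K(t'\mid t,s,n)\;\le\;\frac{2s\,(2\log s+\log n)}{n}+c .$$ -/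

import Mathlib

open scoped ENNReal

/-! ### Conditional prefix Kolmogorov complexity -/

namespace PrefixComplexity

/-- A (conditional) prefix machine: a partial recursive function taking a binary program and a
condition to an output, such that for each condition the set of halting programs is prefix-free.
Conditions and outputs are finite objects, coded by natural numbers. -/
structure IsPrefixMachine (U : List Bool → ℕ →. ℕ) : Prop where
  partrec : Partrec₂ U
  prefixFree : ∀ (y : ℕ) (p q : List Bool), p <+: q → (U p y).Dom → (U q y).Dom → p = q

/-- The conditional complexity `K_U(x | y)` with respect to the machine `U`: the least length in
bits of a program from which `U` computes `x` when given `y` (and `⊤` if there is none). -/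
noncomputable def complexity {β γ : Type*} [Encodable β] [Encodable γ]
    (U : List Bool → ℕ →. ℕ) (x : β) (y : γ) : ℕ∞ :=
  ⨅ p ∈ {p : List Bool | Encodable.encode x ∈ U p (Encodable.encode y)}, (p.length : ℕ∞)

/-- `U` is an (additively) optimal prefix machine, that is, a reference machine for conditional
prefix complexity. -/
structure IsOptimal (U : List Bool → ℕ →. ℕ) : Prop extends IsPrefixMachine U where
  optimal : ∀ V : List Bool → ℕ →. ℕ, IsPrefixMachine V →
    ∃ c : ℕ, ∀ x y : ℕ, complexity U x y ≤ complexity V x y + (c : ℕ∞)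

end PrefixComplexity

/-! ### Existence of an optimal prefix machine -/

namespace PrefixComplexity

/-- Stage `m` of a simulation of the machine coded by `c`, looking for the first halting program
that is comparable with `p`. -/
def simStage (c : Nat.Partrec.Code) (p : List Bool) (y m : ℕ) : Option (Option ℕ) :=
  (Encodable.decode (α := List Bool) m.unpair.2).bind fun q =>
    (c.evaln m.unpair.1 (Nat.pair (Encodable.encode q) y)).bind fun x =>
      if p.take q.length = q ∨ q.take p.length = p then some (if q = p then some x else none)
      else none

/-- A prefix machine, which agrees with the machine coded by `c` if that is a prefix machine. -/
def sim (c : Nat.Partrec.Code) (p : List Bool) (y : ℕ) : Part ℕ :=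
  (Nat.rfindOpt (simStage c p y)).bind fun o => (o : Part ℕ)

/-- The machine which, on a program `1^e 0 p`, runs `p` on the prefix machine number `e`. -/
def universal (p : List Bool) (y : ℕ) : Part ℕ :=
  ((if p.idxOf false < p.length then some () else none : Option Unit) : Part Unit).bind
    fun _ => sim (Denumerable.ofNat Nat.Partrec.Code (p.idxOf false))
      (p.drop (p.idxOf false + 1)) y

theorem simStage_eq_some {c : Nat.Partrec.Code} {p : List Bool} {y m : ℕ} {o : Option ℕ} :
    simStage c p y m = some o ↔
    ∃ q x, Encodable.decode (α := List Bool) m.unpair.2 = some q ∧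
      c.evaln m.unpair.1 (Nat.pair (Encodable.encode q) y) = some x ∧ (q <+: p ∨ p <+: q) ∧
      o = if q = p then some x else none := by
  have key (a b : List Bool) : a.take b.length = b ↔ b <+: a := by
    rw [List.prefix_iff_eq_take, eq_comm]
  simp only [simStage, Option.bind_eq_some_iff, key]
  constructor
  · rintro ⟨q, hq, x, hx, h⟩
    by_cases h1 : q <+: p ∨ p <+: q
    · rw [if_pos h1] at h
      exact ⟨q, x, hq, hx, h1, (Option.some.inj h).symm⟩
    · rw [if_neg h1] at h
      cases h
  · rintro ⟨q, x, hq, hx, h1, h2⟩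
    refine ⟨q, hq, x, hx, ?_⟩
    rw [if_pos h1, h2]

theorem primrec_simStage : Primrec fun a : ((Nat.Partrec.Code × List Bool) × ℕ) × ℕ =>
    simStage a.1.1.1 a.1.1.2 a.1.2 a.2 := by
  unfold simStage
  have hm : Primrec fun a : ((Nat.Partrec.Code × List Bool) × ℕ) × ℕ => a.2.unpair :=
    Primrec.unpair.comp Primrec.snd
  have h1 : Primrec fun a : ((Nat.Partrec.Code × List Bool) × ℕ) × ℕ =>
      Encodable.decode (α := List Bool) a.2.unpair.2 :=
    Primrec.decode.comp (Primrec.snd.comp hm)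
  have hq : Primrec fun a : (((Nat.Partrec.Code × List Bool) × ℕ) × ℕ) × List Bool => a.2 :=
    Primrec.snd
  have h4 : Primrec fun a : (((Nat.Partrec.Code × List Bool) × ℕ) × ℕ) × List Bool =>
      ((a.1.2.unpair.1, a.1.1.1.1), Nat.pair (Encodable.encode a.2) a.1.1.2) :=
    Primrec.pair (Primrec.pair (Primrec.fst.comp (hm.comp Primrec.fst))
      (Primrec.fst.comp (Primrec.fst.comp (Primrec.fst.comp Primrec.fst))))
      (Primrec₂.natPair.comp (Primrec.encode.comp hq)
        (Primrec.snd.comp (Primrec.fst.comp Primrec.fst)))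
  have h5 := Nat.Partrec.Code.primrec_evaln.comp h4
  dsimp only at h5
  have hp : Primrec fun a : ((((Nat.Partrec.Code × List Bool) × ℕ) × ℕ) × List Bool) × ℕ =>
      a.1.1.1.1.2 :=
    Primrec.snd.comp (Primrec.fst.comp (Primrec.fst.comp (Primrec.fst.comp Primrec.fst)))
  have hq' : Primrec fun a : ((((Nat.Partrec.Code × List Bool) × ℕ) × ℕ) × List Bool) × ℕ =>
      a.1.2 := Primrec.snd.comp Primrec.fst
  have take_eq {β : Type} [Primcodable β] {f g : β → List Bool} (hf : Primrec f)
      (hg : Primrec g) : PrimrecPred fun b => (f b).take (g b).length = g b :=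
    Primrec.eq.comp (Primrec.list_take.comp (Primrec.list_length.comp hg) hf) hg
  have h6 : Primrec fun a : ((((Nat.Partrec.Code × List Bool) × ℕ) × ℕ) × List Bool) × ℕ =>
      if a.1.2 = a.1.1.1.1.2 then some a.2 else none :=
    Primrec.ite (Primrec.eq.comp hq' hp) (Primrec.option_some.comp Primrec.snd)
      (Primrec.const none)
  have h7 : Primrec₂ fun (a : (((Nat.Partrec.Code × List Bool) × ℕ) × ℕ) × List Bool) (x : ℕ) =>
      if a.1.1.1.2.take a.2.length = a.2 ∨ a.2.take a.1.1.1.2.length = a.1.1.1.2 then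
        some (if a.2 = a.1.1.1.2 then some x else none) else none :=
    Primrec.ite (PrimrecPred.or (take_eq hp hq') (take_eq hq' hp))
      (Primrec.option_some.comp h6) (Primrec.const none)
  exact Primrec.option_bind h1 (Primrec.option_bind h5 h7)

theorem partrec_sim : Partrec fun a : (Nat.Partrec.Code × List Bool) × ℕ =>
    sim a.1.1 a.1.2 a.2 := by
  unfold sim
  exact (Partrec.rfindOpt (Primrec.to_comp primrec_simStage)).bind
    (Computable.ofOption Computable.snd)

theorem mem_sim_iff {c : Nat.Partrec.Code} {p : List Bool} {y x : ℕ} :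
    x ∈ sim c p y ↔ ∃ m, simStage c p y m = some (some x) ∧ ∀ k < m, simStage c p y k = none := by
  simp only [sim, Nat.rfindOpt, Part.mem_bind_iff]
  constructor
  · rintro ⟨o, ⟨m, h, h2⟩, h3⟩
    obtain ⟨-, h1⟩ := Nat.mem_rfind.1 h
    refine ⟨m, ?_, fun k hk => ?_⟩
    · rw [Part.mem_ofOption.1 h2, Part.mem_ofOption.1 h3]
    · simpa using h1 hk
  · rintro ⟨m, h1, h2⟩
    refine ⟨some x, ⟨m, Nat.mem_rfind.2 ⟨?_, fun {k} hk => ?_⟩, ?_⟩, ?_⟩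
    · simp [h1]
    · simp [h2 k hk]
    · simp [h1]
    · simp

theorem sim_prefixFree {c : Nat.Partrec.Code} {y : ℕ} {p q : List Bool} (h : p <+: q)
    (hp : (sim c p y).Dom) (hq : (sim c q y).Dom) : p = q := by
  obtain ⟨m, hm, hm'⟩ := mem_sim_iff.1 (Part.get_mem hp)
  obtain ⟨k, hk, hk'⟩ := mem_sim_iff.1 (Part.get_mem hq)
  obtain ⟨a, x, ha, hx, -, e⟩ := simStage_eq_some.1 hm
  obtain ⟨b, z, hb, hz, -, e'⟩ := simStage_eq_some.1 hk
  have hap : a = p := by by_contra h; simp [h] at e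
  have hbq : b = q := by by_contra h; simp [h] at e'
  subst hap hbq
  rcases lt_trichotomy m k with hlt | rfl | hlt
  · have := hk' m hlt
    rw [simStage_eq_some.2 ⟨a, x, ha, hx, Or.inl h, rfl⟩] at this
    simp at this
  · simpa using ha.symm.trans hb
  · have := hm' k hlt
    rw [simStage_eq_some.2 ⟨b, z, hb, hz, Or.inr h, rfl⟩] at this
    simp at this

theorem mem_sim {V : List Bool → ℕ →. ℕ} {c : Nat.Partrec.Code} (hV : IsPrefixMachine V)
    (hc : ∀ q y, c.eval (Nat.pair (Encodable.encode q) y) = V q y) {x y : ℕ} {p : List Bool}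
    (hx : x ∈ V p y) : x ∈ sim c p y := by
  have good : ∀ m o, simStage c p y m = some o → o = some x := by
    intro m o h
    obtain ⟨q, z, -, hz, hc', rfl⟩ := simStage_eq_some.1 h
    have hz' : z ∈ V q y := by rw [← hc]; exact Nat.Partrec.Code.evaln_sound hz
    have hqp : q = p := by
      rcases hc' with h | h
      · exact hV.prefixFree y q p h (Part.dom_iff_mem.2 ⟨_, hz'⟩) (Part.dom_iff_mem.2 ⟨_, hx⟩)
      · exact (hV.prefixFree y p q h (Part.dom_iff_mem.2 ⟨_, hx⟩)
          (Part.dom_iff_mem.2 ⟨_, hz'⟩)).symm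
    subst hqp
    simp [Part.mem_unique hz' hx]
  have ex : ∃ m, simStage c p y m ≠ none := by
    rw [← hc] at hx
    obtain ⟨k, hk⟩ := Nat.Partrec.Code.evaln_complete.1 hx
    refine ⟨Nat.pair k (Encodable.encode p), ?_⟩
    rw [simStage_eq_some.2 ⟨p, x, by simp, by simpa using hk, Or.inl List.prefix_rfl, rfl⟩]
    simp
  classical
  refine mem_sim_iff.2 ⟨Nat.find ex, ?_, fun k hk => ?_⟩
  · obtain ⟨o, ho⟩ := Option.ne_none_iff_exists'.1 (Nat.find_spec ex)
    rw [ho, good _ _ ho]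
  · simpa using Nat.find_min ex hk

theorem isPrefixMachine_universal : IsPrefixMachine universal := by
  refine ⟨?_, ?_⟩
  · have hi : Primrec fun a : List Bool × ℕ => a.1.idxOf false :=
      Primrec.list_idxOf.comp (Primrec.const false) Primrec.fst
    have h1 : Primrec fun a : List Bool × ℕ =>
        (if a.1.idxOf false < a.1.length then some () else none : Option Unit) :=
      Primrec.ite (Primrec.nat_lt.comp hi (Primrec.list_length.comp Primrec.fst))
        (Primrec.const _) (Primrec.const _)
    have h2 : Primrec fun a : List Bool × ℕ =>
        ((Denumerable.ofNat Nat.Partrec.Code (a.1.idxOf false),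
          a.1.drop (a.1.idxOf false + 1)), a.2) :=
      Primrec.pair (Primrec.pair ((Primrec.ofNat _).comp hi)
        (Primrec.list_drop.comp (Primrec.succ.comp hi) Primrec.fst)) Primrec.snd
    have aux : ∀ f : (Nat.Partrec.Code × List Bool) × ℕ →. ℕ, Partrec f →
        Partrec fun a : List Bool × ℕ =>
          ((if a.1.idxOf false < a.1.length then some () else none : Option Unit) :
            Part Unit).bind fun _ => f ((Denumerable.ofNat Nat.Partrec.Code (a.1.idxOf false),
              a.1.drop (a.1.idxOf false + 1)), a.2) := fun f hf =>
      Partrec.bind (Computable.ofOption h1.to_comp)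
        (Partrec.comp hf ((Primrec.to_comp h2).comp Computable.fst))
    exact aux _ partrec_sim
  · intro y p q h hp hq
    obtain ⟨x, hx⟩ := Part.dom_iff_mem.1 hp
    obtain ⟨z, hz⟩ := Part.dom_iff_mem.1 hq
    simp only [universal, Part.mem_bind_iff, Part.mem_coe] at hx hz
    obtain ⟨_, hp', hx⟩ := hx
    obtain ⟨_, -, hz⟩ := hz
    have hlt : p.idxOf false < p.length := by
      by_contra hcon
      simp [hcon] at hp'
    have hmem : false ∈ p := List.idxOf_lt_length_iff.1 hlt
    obtain ⟨r, rfl⟩ := h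
    rw [List.idxOf_append_of_mem hmem, List.drop_append_of_le_length (by omega)] at hz
    have := sim_prefixFree (List.prefix_append _ r) (Part.dom_iff_mem.2 ⟨_, hx⟩)
      (Part.dom_iff_mem.2 ⟨_, hz⟩)
    have hr : r = [] := by simpa using this
    simp [hr]

/-- Optimal prefix machines exist. -/
theorem isOptimal_universal : IsOptimal universal := by
  refine ⟨isPrefixMachine_universal, fun V hV => ?_⟩
  obtain ⟨c, hc⟩ := Nat.Partrec.Code.exists_code.1 hV.partrec
  have hc' : ∀ q y, c.eval (Nat.pair (Encodable.encode q) y) = V q y := by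
    intro q y
    have := congrFun hc (Encodable.encode (q, y))
    rw [Encodable.encode_prod_val] at this
    simp only [Encodable.encode_nat] at this
    rw [this]
    have e : Encodable.decode (α := List Bool × ℕ) (Nat.pair (Encodable.encode q) y) =
      some (q, y) := Encodable.encodek (q, y)
    rw [e]
    simp only [Part.coe_some, Part.bind_some]
    exact Part.map_id' (fun _ => rfl) _
  refine ⟨Encodable.encode c + 1, fun x y => ?_⟩
  unfold complexity
  rw [ENat.iInf_add]
  refine le_iInf fun p => ?_
  rw [ENat.iInf_add]
  refine le_iInf fun hp => ?_
  have hmem : Encodable.encode x ∈ universal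
      (List.replicate (Encodable.encode c) true ++ false :: p) (Encodable.encode y) := by
    have hi : (List.replicate (Encodable.encode c) true ++ false :: p).idxOf false =
        Encodable.encode c := by
      rw [List.idxOf_append_of_notMem (by simp [List.mem_replicate])]
      simp
    have hd : (List.replicate (Encodable.encode c) true ++ false :: p).drop
        (Encodable.encode c + 1) = p := by
      rw [List.drop_append]
      simp
    rw [universal, hi, hd]
    simp only [Denumerable.ofNat_encode]
    rw [if_pos (by simp)]
    simp only [Part.coe_some, Part.bind_some]
    exact mem_sim hV hc' hp
  refine (iInf₂_le (f := fun (r : List Bool)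
    (_ : r ∈ {r | Encodable.encode x ∈ universal r (Encodable.encode y)}) => (r.length : ℕ∞))
    _ hmem).trans (le_of_eq ?_)
  simp
  ring

end PrefixComplexity

/-! ### The greedy algorithm for common superstrings -/

namespace GreedySuperstring

variable {α : Type*} [DecidableEq α]

/-- The length of the longest suffix of `u` that is a prefix of `v`. -/
def overlap (u v : List α) : ℕ :=
  Nat.findGreatest (fun k => v.take k <:+ u) v.length

/-- `u` followed by `v`, with the two copies of their longest overlap identified. -/
def merge (u v : List α) : List α :=
  u ++ v.drop (overlap u v)

/-- One step of Greedy: an (ordered) pair of distinct strings whose overlap is maximum among all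
such pairs is replaced by its merge. Ties may be broken in any way. -/
def Step (S T : Finset (List α)) : Prop :=
  ∃ u ∈ S, ∃ v ∈ S, u ≠ v ∧
    (∀ u' ∈ S, ∀ v' ∈ S, u' ≠ v' → overlap u' v' ≤ overlap u v) ∧
    T = insert (merge u v) ((S.erase u).erase v)

/-- `t'` is a possible result of running Greedy on the set `S` until one string is left. -/
def IsOutput (S : Finset (List α)) (t' : List α) : Prop :=
  Relation.ReflTransGen Step S {t'}

end GreedySuperstring

/-! Every symbol of `t'` lies in some length-`n` substring of `t`: the examples have this property
and merging along an overlap preserves it (`Covered.merge`). Cut `t'` from left to right into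
blocks, each a full window followed by the gap up to the next window start. A gap is shorter than
`n` and lies inside one window (`Covered.exists_gap`), so a block is fixed by two positions in `t`
and a gap length, at most `s * s * n` choices. Blocks have length at least `n`, so there are at most
`2 * s / n` of them, and a number below `codeBound s n` encodes them all (`Covered.exists_code`).

The program is this number in binary, padded to a length computable from `s` and `n`. For each
condition all valid programs thus have equal length and are prefix-free
(`length_eq_of_blockDecode`); optimality of `U` then costs only a constant. -/

namespace GreedySuperstring

variable {α : Type*}

/-! ### Covering by windows and its preservation under merging -/

/-- An occurrence in `w`, at position `j`, of a substring of `t` of length `n`. -/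
def Window (t : List α) (n : ℕ) (w : List α) (j : ℕ) : Prop :=
  j + n ≤ w.length ∧ (w.drop j).take n <:+: t

/-- Every position of `w` lies in a window, that is, `w` is covered by substrings of `t` of
length `n`. -/
def Covered (t : List α) (n : ℕ) (w : List α) : Prop :=
  ∀ i < w.length, ∃ j ≤ i, i < j + n ∧ Window t n w j

theorem covered_of_infix {t w : List α} (h : w <:+: t) : Covered t w.length w := fun i hi =>
  ⟨0, Nat.zero_le i, by omega, by omega, by simpa using h⟩

theorem Window.append_right {t u : List α} {n j : ℕ} (h : Window t n u j) (v : List α) :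
    Window t n (u ++ v) j := by
  obtain ⟨h1, h2⟩ := h
  refine ⟨by simp; omega, ?_⟩
  rwa [List.drop_append_of_le_length (by omega), List.take_append_of_le_length (by simp; omega)]

theorem Window.append_left {t v : List α} {n j : ℕ} (h : Window t n v j) (u : List α) :
    Window t n (u ++ v) (u.length + j) := by
  obtain ⟨h1, h2⟩ := h
  refine ⟨by simp; omega, ?_⟩
  rwa [List.drop_append, List.drop_eq_nil_of_le (by omega), List.nil_append,
    Nat.add_sub_cancel_left]

/-- The merge contains both `u` and `v` intact, as a prefix and as a suffix, so the windows of each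
survive, those of `v` after a shift. -/
theorem Covered.merge [DecidableEq α] {t u v : List α} {n : ℕ} (hu : Covered t n u)
    (hv : Covered t n v) : Covered t n (merge u v) := by
  have hk : v.take (overlap u v) <:+ u :=
    Nat.findGreatest_spec (P := fun k => v.take k <:+ u) (Nat.zero_le _) (by simp)
  obtain ⟨r, hr⟩ := hk
  have e : GreedySuperstring.merge u v = r ++ v := by
    have : u ++ v.drop (overlap u v) = (r ++ v.take (overlap u v)) ++ v.drop (overlap u v) := by
      rw [hr]
    rw [GreedySuperstring.merge, this, List.append_assoc, List.take_append_drop]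
  intro i hi
  by_cases h : i < u.length
  · obtain ⟨j, h1, h2, h3⟩ := hu i h
    exact ⟨j, h1, h2, h3.append_right _⟩
  · have hru : r.length ≤ u.length := by rw [← hr]; simp
    rw [e] at hi ⊢
    rw [List.length_append] at hi
    obtain ⟨j, h1, h2, h3⟩ := hv (i - r.length) (by omega)
    exact ⟨r.length + j, by omega, by omega, h3.append_left _⟩

theorem IsOutput.covered [DecidableEq α] {t t' : List α} {n : ℕ} {S : Finset (List α)}
    (hS : ∀ x ∈ S, Covered t n x) (h : IsOutput S t') : Covered t n t' := by
  have key : ∀ T, Relation.ReflTransGen Step S T → ∀ x ∈ T, Covered t n x := by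
    intro T hT
    induction hT with
    | refl => exact hS
    | tail _ hstep ih =>
      obtain ⟨u, hu, v, hv, -, -, rfl⟩ := hstep
      intro x hx
      rcases Finset.mem_insert.1 hx with rfl | hx
      · exact (ih u hu).merge (ih v hv)
      · exact ih x (Finset.mem_of_mem_erase (Finset.mem_of_mem_erase hx))
  exact key _ h t' (Finset.mem_singleton_self t')

/-! ### Cutting a covered string into blocks -/

/-- A part of a window can be read off from `t`. -/
theorem Window.exists_eq {t w : List α} {n j : ℕ} (h : Window t n w j) {b l : ℕ}
    (hb : j ≤ b) (hl : b + l ≤ j + n) (hl' : 0 < l) :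
    ∃ i < t.length, (w.drop b).take l = (t.drop i).take l := by
  obtain ⟨h1, r, r', h2⟩ := h
  refine ⟨r.length + (b - j), ?_, ?_⟩
  · have := congrArg List.length h2
    simp at this
    omega
  · have e : (w.drop b).take l = (((w.drop j).take n).drop (b - j)).take l := by
      rw [List.drop_take, List.drop_drop, List.take_take]
      congr 2 <;> omega
    rw [e, ← h2, List.append_assoc, ← List.drop_drop, List.drop_left,
      List.drop_append_of_le_length (by simp; omega),
      List.take_append_of_le_length (by simp; omega)]

/-- Between a position of a covered string and the start of the next window there is a part
of a single window. -/
theorem Covered.exists_gap {t w : List α} {n b : ℕ} (h : Covered t n w) (ht : 0 < t.length)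
    (hn : 0 < n) (hb : b ≤ w.length) :
    ∃ l < n, b + l ≤ w.length ∧ (b + l = w.length ∨ Window t n w (b + l)) ∧
      ∃ i < t.length, (w.drop b).take l = (t.drop i).take l := by
  classical
  -- The gap ends at the first window start at or after `b`, or at the end of `w`.
  have ex : ∃ l, b + l = w.length ∨ Window t n w (b + l) := ⟨w.length - b, by omega⟩
  have hle : b + Nat.find ex ≤ w.length := by
    rcases Nat.find_spec ex with h | h
    · exact h.le
    · have := h.1
      omega
  rcases Nat.eq_zero_or_pos (Nat.find ex) with h0 | h0
  · exact ⟨Nat.find ex, by omega, hle, Nat.find_spec ex, 0, ht, by simp [h0]⟩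
  -- The window covering the last symbol of the gap starts before `b`, by minimality. It therefore
  -- contains the whole gap, and this forces `l < n`.
  · obtain ⟨j, h1, h2, h3⟩ := h (b + Nat.find ex - 1) (by omega)
    have hj : j < b := by
      by_contra hj
      refine Nat.find_min ex (m := j - b) (by omega) (Or.inr ?_)
      rwa [Nat.add_sub_cancel' (by omega)]
    exact ⟨Nat.find ex, by omega, hle, Nat.find_spec ex,
      h3.exists_eq (by omega) (by omega) h0⟩

/-! ### Blocks as digits of a number -/

/-- The base of the positional system in which block descriptions are digits. -/
def base (s n : ℕ) : ℕ := max 2 (s * s * n)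

/-- The block described by the digit `d = i + s * (j + s * l)`: the substring of `t` of length
`n` at position `i`, followed by that of length `l` at position `j`. -/
def block (t : List α) (s n d : ℕ) : List α :=
  (t.drop (d % s)).take n ++ (t.drop (d / s % s)).take (d / s / s)

/-- Split off the last digit of a number, and append the block it describes to a string. The
leading digit `1` marks the end. -/
def blockStep (t : List α) (s n : ℕ) (a : ℕ × List α) : ℕ × List α :=
  if a.1 ≤ 1 then a else (a.1 / base s n, a.2 ++ block t s n (a.1 % base s n))

theorem blockStep_iterate_one (t : List α) (s n k : ℕ) (w : List α) :
    (blockStep t s n)^[k] (1, w) = (1, w) := Function.iterate_fixed rfl k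

theorem block_digit (t : List α) {s n i j l : ℕ} (hi : i < s) (hj : j < s) :
    block t s n (i + s * (j + s * l)) = (t.drop i).take n ++ (t.drop j).take l := by
  have hs : 0 < s := by omega
  simp only [block, Nat.add_mul_mod_self_left, Nat.add_mul_div_left _ _ hs, Nat.div_eq_of_lt hi,
    Nat.div_eq_of_lt hj, Nat.mod_eq_of_lt hi, Nat.mod_eq_of_lt hj, zero_add]

theorem digit_lt {s n i j l : ℕ} (hi : i < s) (hj : j < s) (hl : l < n) :
    i + s * (j + s * l) < base s n := by
  have h1 : j + s * l + 1 ≤ s * n := by nlinarith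
  have h2 : i + s * (j + s * l) < s * s * n := by nlinarith
  exact h2.trans_le (le_max_right _ _)

/-- The part of a covered string that follows the start of a window is described by a number
with one digit for each `n` symbols. -/
theorem Covered.exists_code {t w : List α} {n : ℕ} (h : Covered t n w) (ht : 0 < t.length)
    (hn : 0 < n) (r : ℕ) : ∀ a, a + r = w.length → (a = w.length ∨ Window t n w a) →
    ∃ k N, k * n ≤ r ∧ 1 ≤ N ∧ N < 2 * base t.length n ^ k ∧
      ∀ v, (blockStep t t.length n)^[k] (N, v) = (1, v ++ w.drop a) := by
  induction r using Nat.strong_induction_on with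
  | _ r ih =>
    intro a har ha
    by_cases h0 : a = w.length
    · exact ⟨0, 1, by simp, le_rfl, by simp, fun v => by simp [h0]⟩
    have hw : Window t n w a := ha.resolve_left h0
    have hlen := hw.1
    obtain ⟨i, hi, ei⟩ := hw.exists_eq le_rfl le_rfl hn
    obtain ⟨l, hl, hle, hnext, j, hj, ej⟩ := h.exists_gap ht hn hlen
    obtain ⟨k, N, hk, hN, hN', hdec⟩ := ih (r - n - l) (by omega) (a + n + l) (by omega) hnext
    set B := base t.length n with hB
    have hd : i + t.length * (j + t.length * l) < B := digit_lt hi hj hl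
    have hbl := block_digit t (n := n) (l := l) hi hj
    generalize i + t.length * (j + t.length * l) = d at hd hbl
    -- The maximum in `base` matters here: for `s = n = 1` the product is 1, and in base 1 the end
    -- marker could not be told from a remaining digit.
    have hB2 : 2 ≤ B := le_max_left _ _
    -- The current block becomes the least significant digit, so that decoding yields the blocks
    -- from left to right.
    refine ⟨k + 1, d + B * N, ?_, ?_, ?_, fun v => ?_⟩
    · rw [add_mul]
      omega
    · nlinarith
    · rw [pow_succ]
      nlinarith
    · have hgt : ¬ d + B * N ≤ 1 := by nlinarith
      rw [Function.iterate_succ_apply, blockStep, if_neg hgt, ← hB]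
      simp only [Nat.add_mul_mod_self_left, Nat.mod_eq_of_lt hd,
        Nat.add_mul_div_left _ _ (show 0 < B by omega), Nat.div_eq_of_lt hd, zero_add]
      rw [hdec, hbl, ← ei, ← ej, List.append_assoc, List.append_assoc,
        ← List.drop_drop (i := l) (j := a + n), List.take_append_drop,
        ← List.drop_drop (i := n) (j := a), List.take_append_drop]

/-- The number of rounds must not depend on `w`, since the decoder knows only the bound `m`; surplus
rounds leave the end marker fixed. -/
theorem Covered.exists_code_of_length_le {t w : List α} {n m : ℕ} (h : Covered t n w)
    (ht : 0 < t.length) (hn : 0 < n) (hm : w.length ≤ m) :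
    ∃ N < 2 * base t.length n ^ (m / n),
      ((blockStep t t.length n)^[m / n] (N, [])).2 = w := by
  have hstart : 0 = w.length ∨ Window t n w 0 := by
    rcases Nat.eq_zero_or_pos w.length with h0 | h0
    · exact Or.inl h0.symm
    · obtain ⟨j, hj, -, hw⟩ := h 0 h0
      -- The window covering position 0 must start there.
      rw [Nat.le_zero.1 hj] at hw
      exact Or.inr hw
  obtain ⟨k, N, hk, -, hN, hdec⟩ := h.exists_code ht hn w.length 0 (zero_add _) hstart
  have hkm : k ≤ m / n := (Nat.le_div_iff_mul_le hn).2 (hk.trans hm)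
  have hB : 1 ≤ base t.length n := one_le_two.trans (le_max_left _ _)
  refine ⟨N, hN.trans_le (Nat.mul_le_mul_left _ (Nat.pow_le_pow_right hB hkm)), ?_⟩
  obtain ⟨e, he⟩ := Nat.exists_eq_add_of_le' hkm
  rw [he, Function.iterate_add_apply, hdec, blockStep_iterate_one]
  simp

end GreedySuperstring

/-! ### Binary programs and the decoding machine -/

/-- The number with the given binary digits, the first being the most significant. -/
def ofBits (p : List Bool) : ℕ := p.foldl (fun a b => 2 * a + cond b 1 0) 0

theorem exists_ofBits_eq (L : ℕ) : ∀ N < 2 ^ L, ∃ p : List Bool, p.length = L ∧ ofBits p = N := by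
  induction L with
  | zero => exact fun N hN => ⟨[], rfl, by simp [ofBits]; omega⟩
  | succ L ih =>
    intro N hN
    obtain ⟨p, hp, hpN⟩ := ih (N / 2) (by rw [pow_succ] at hN; omega)
    refine ⟨p ++ [decide (N % 2 = 1)], by simp [hp], ?_⟩
    rw [ofBits, List.foldl_append, ← ofBits, hpN]
    rcases Nat.mod_two_eq_zero_or_one N with h | h <;> simp [h] <;> omega

namespace PrefixComplexity

open GreedySuperstring

section Machine

variable {α : Type*}

/-- A bound for the numbers that describe strings of length at most `2 * s` by blocks. -/
def codeBound (s n : ℕ) : ℕ := 2 * base s n ^ (2 * s / n)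

/-- The output of the block decoder. It accepts programs of a single length only. -/
def blockDecode (p : List Bool) (y : List α × ℕ × ℕ) : Option (List α) :=
  if codeBound y.2.1 y.2.2 ≤ 2 ^ p.length ∧ 2 ^ p.length < 2 * codeBound y.2.1 y.2.2 then
    some ((blockStep y.1 y.2.1 y.2.2)^[2 * y.2.1 / y.2.2] (ofBits p, [])).2
  else none

/-- Only one power of two lies in `[M, 2 * M)`, where `M` is the code bound determined by `y`. -/
theorem length_eq_of_blockDecode {p q : List Bool} {y : List α × ℕ × ℕ}
    (hp : (blockDecode p y).isSome) (hq : (blockDecode q y).isSome) : p.length = q.length := by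
  have key : ∀ {p : List Bool}, (blockDecode p y).isSome →
      codeBound y.2.1 y.2.2 ≤ 2 ^ p.length ∧ 2 ^ p.length < 2 * codeBound y.2.1 y.2.2 := by
    intro p hp
    by_contra hcon
    simp [blockDecode, hcon] at hp
  have lt : ∀ {a b : ℕ}, 2 ^ a < 2 * 2 ^ b → a ≤ b := fun {a b} h => by
    rw [← pow_succ'] at h
    exact Nat.lt_succ_iff.1 ((Nat.pow_lt_pow_iff_right one_lt_two).1 h)
  obtain ⟨p1, p2⟩ := key hp
  obtain ⟨q1, q2⟩ := key hq
  exact le_antisymm (lt (by omega)) (lt (by omega))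

/-- The block decoder as a machine. -/
def blockMachine (α : Type*) [Encodable α] (p : List Bool) (y : ℕ) : Part ℕ :=
  (((Encodable.decode (α := List α × ℕ × ℕ) y).bind fun z =>
    (blockDecode p z).map Encodable.encode : Option ℕ) : Part ℕ)

theorem primrec_pow : Primrec₂ fun a b : ℕ => a ^ b := by
  have h : Primrec₂ fun a b : ℕ => (Nat.rec 1 (fun _ c => c * a) b : ℕ) :=
    Primrec.nat_rec (Primrec.const 1)
      (Primrec.nat_mul.comp (Primrec.snd.comp Primrec.snd) Primrec.fst).to₂
  refine h.of_eq fun a b => ?_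
  induction b with
  | zero => rfl
  | succ b ih => rw [pow_succ, ← ih]

theorem primrec_ofBits : Primrec ofBits := by
  have h : Primrec₂ fun (_ : List Bool) (a : ℕ × Bool) => 2 * a.1 + cond a.2 1 0 :=
    Primrec.nat_add.comp
      (Primrec.nat_mul.comp (Primrec.const 2) (Primrec.fst.comp Primrec.snd))
      (Primrec.cond (Primrec.snd.comp Primrec.snd) (Primrec.const 1) (Primrec.const 0))
  exact Primrec.list_foldl Primrec.id (Primrec.const 0) h

theorem primrec_base : Primrec₂ base :=
  Primrec.nat_max.comp (Primrec.const 2)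
    (Primrec.nat_mul.comp (Primrec.nat_mul.comp Primrec.fst Primrec.fst) Primrec.snd)

theorem primrec_codeBound : Primrec₂ codeBound :=
  Primrec.nat_mul.comp (Primrec.const 2) (primrec_pow.comp primrec_base
    (Primrec.nat_div.comp (Primrec.nat_mul.comp (Primrec.const 2) Primrec.fst) Primrec.snd))

variable [Primcodable α]

theorem primrec_block : Primrec fun a : (List α × ℕ × ℕ) × ℕ =>
    block a.1.1 a.1.2.1 a.1.2.2 a.2 := by
  have ht : Primrec fun a : (List α × ℕ × ℕ) × ℕ => a.1.1 := Primrec.fst.comp Primrec.fst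
  have hs : Primrec fun a : (List α × ℕ × ℕ) × ℕ => a.1.2.1 :=
    Primrec.fst.comp (Primrec.snd.comp Primrec.fst)
  have hn : Primrec fun a : (List α × ℕ × ℕ) × ℕ => a.1.2.2 :=
    Primrec.snd.comp (Primrec.snd.comp Primrec.fst)
  have hq : Primrec fun a : (List α × ℕ × ℕ) × ℕ => a.2 / a.1.2.1 :=
    Primrec.nat_div.comp Primrec.snd hs
  exact Primrec.list_append.comp
    (Primrec.list_take.comp hn (Primrec.list_drop.comp (Primrec.nat_mod.comp Primrec.snd hs) ht))
    (Primrec.list_take.comp (Primrec.nat_div.comp hq hs)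
      (Primrec.list_drop.comp (Primrec.nat_mod.comp hq hs) ht))

theorem primrec_blockStep : Primrec₂ fun (y : List α × ℕ × ℕ) (a : ℕ × List α) =>
    blockStep y.1 y.2.1 y.2.2 a := by
  have hN : Primrec fun a : (List α × ℕ × ℕ) × ℕ × List α => a.2.1 :=
    Primrec.fst.comp Primrec.snd
  have hB : Primrec fun a : (List α × ℕ × ℕ) × ℕ × List α => base a.1.2.1 a.1.2.2 :=
    primrec_base.comp (Primrec.fst.comp (Primrec.snd.comp Primrec.fst))
      (Primrec.snd.comp (Primrec.snd.comp Primrec.fst))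
  exact Primrec.ite (Primrec.nat_le.comp hN (Primrec.const 1)) Primrec.snd
    (Primrec.pair (Primrec.nat_div.comp hN hB)
      (Primrec.list_append.comp (Primrec.snd.comp Primrec.snd)
        (primrec_block.comp (Primrec.pair Primrec.fst (Primrec.nat_mod.comp hN hB)))))

theorem primrec_blockDecode : Primrec₂ (blockDecode (α := α)) := by
  have hs : Primrec fun a : List Bool × List α × ℕ × ℕ => a.2.2.1 :=
    Primrec.fst.comp (Primrec.snd.comp Primrec.snd)
  have hn : Primrec fun a : List Bool × List α × ℕ × ℕ => a.2.2.2 :=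
    Primrec.snd.comp (Primrec.snd.comp Primrec.snd)
  have hM := primrec_codeBound.comp hs hn
  have hL : Primrec fun a : List Bool × List α × ℕ × ℕ => 2 ^ a.1.length :=
    primrec_pow.comp (Primrec.const 2) (Primrec.list_length.comp Primrec.fst)
  have hit : Primrec fun a : List Bool × List α × ℕ × ℕ =>
      (blockStep a.2.1 a.2.2.1 a.2.2.2)^[2 * a.2.2.1 / a.2.2.2] (ofBits a.1, []) :=
    Primrec.nat_iterate (Primrec.nat_div.comp (Primrec.nat_mul.comp (Primrec.const 2) hs) hn)
      (Primrec.pair (primrec_ofBits.comp Primrec.fst) (Primrec.const []))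
      (primrec_blockStep.comp (Primrec.snd.comp Primrec.fst) Primrec.snd)
  exact Primrec.ite (PrimrecPred.and (Primrec.nat_le.comp hM hL)
      (Primrec.nat_lt.comp hL (Primrec.nat_mul.comp (Primrec.const 2) hM)))
    (Primrec.option_some.comp (Primrec.snd.comp hit)) (Primrec.const none)

/-- Two halting programs for one condition have equal length, so if one is a prefix of the other
they coincide. -/
theorem isPrefixMachine_blockMachine : IsPrefixMachine (blockMachine α) := by
  refine ⟨?_, fun y p q hpq hp hq => ?_⟩
  · have h : Primrec fun a : List Bool × ℕ =>
        (Encodable.decode (α := List α × ℕ × ℕ) a.2).bind fun z =>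
          (blockDecode a.1 z).map Encodable.encode :=
      Primrec.option_bind (Primrec.decode.comp Primrec.snd)
        (Primrec.option_map
          (primrec_blockDecode.comp (Primrec.fst.comp Primrec.fst) Primrec.snd)
          (Primrec.encode.comp Primrec.snd))
    exact Computable.ofOption h.to_comp
  · have key : ∀ {p : List Bool}, (blockMachine α p y).Dom →
        ∃ z, Encodable.decode (α := List α × ℕ × ℕ) y = some z ∧ (blockDecode p z).isSome := by
      intro p hp
      obtain ⟨x, hx⟩ := Part.dom_iff_mem.1 hp
      obtain ⟨z, hz, h⟩ := Option.bind_eq_some_iff.1 (Part.mem_ofOption.1 hx)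
      obtain ⟨w, hw, -⟩ := Option.map_eq_some_iff.1 h
      exact ⟨z, hz, by simp [hw]⟩
    obtain ⟨z, hz, hpz⟩ := key hp
    obtain ⟨z', hz', hqz⟩ := key hq
    obtain rfl : z = z' := Option.some.inj (hz.symm.trans hz')
    exact hpq.eq_of_length (length_eq_of_blockDecode hpz hqz)

theorem exists_complexity_blockMachine_le {t w : List α} {n : ℕ} (h : Covered t n w)
    (ht : 0 < t.length) (hn : 0 < n) (hw : w.length ≤ 2 * t.length) :
    ∃ L : ℕ, 2 ^ L < 2 * codeBound t.length n ∧
      complexity (blockMachine α) (Encodable.encode w) (Encodable.encode (t, t.length, n)) ≤ L := by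
  obtain ⟨N, hN, hdec⟩ := h.exists_code_of_length_le ht hn hw
  have hM : 1 < codeBound t.length n := by
    have : 0 < base t.length n ^ (2 * t.length / n) :=
      Nat.pow_pos (two_pos.trans_le (le_max_left _ _))
    unfold codeBound
    omega
  -- Rounding the logarithm up gives the single length that the decoder accepts.
  set L := Nat.clog 2 (codeBound t.length n) with hL
  have h1 : codeBound t.length n ≤ 2 ^ L := Nat.le_pow_clog one_lt_two _
  have h2 : 2 ^ L < 2 * codeBound t.length n := by
    have h3 := Nat.pow_pred_clog_lt_self one_lt_two hM
    have h4 : 0 < L := Nat.clog_pos one_lt_two hM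
    rw [← hL] at h3
    obtain ⟨m, hm⟩ := Nat.exists_eq_succ_of_ne_zero h4.ne'
    rw [hm] at h3 ⊢
    rw [pow_succ']
    exact Nat.mul_lt_mul_of_pos_left h3 two_pos
  obtain ⟨p, hp, hpN⟩ := exists_ofBits_eq L N (hN.trans_le h1)
  refine ⟨L, h2, ?_⟩
  have hmem : Encodable.encode w ∈ blockMachine α p (Encodable.encode (t, t.length, n)) := by
    rw [blockMachine, Encodable.encodek, Option.bind_some, blockDecode, hp, if_pos ⟨h1, h2⟩, hpN,
      hdec]
    exact Part.mem_ofOption.2 rfl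
  rw [← hp]
  exact iInf₂_le (f := fun (r : List Bool)
    (_ : r ∈ {r | Encodable.encode w ∈
      blockMachine α r (Encodable.encode (t, t.length, n))}) => (r.length : ℕ∞)) p hmem

end Machine

/-! ### Program length in terms of logarithms -/

open Real in
theorem le_of_two_pow_lt_codeBound {s n L : ℕ} (hs : 1 ≤ s) (hn : 1 ≤ n)
    (h : 2 ^ L < 2 * codeBound s n) :
    (L : ℝ) ≤ 2 * s * (2 * logb 2 s + logb 2 n) / n + 4 := by
  have hs' : (1 : ℝ) ≤ s := by exact_mod_cast hs
  have hn' : (1 : ℝ) ≤ n := by exact_mod_cast hn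
  have hlog : 0 ≤ 2 * logb 2 (s : ℝ) + logb 2 n := by
    have := logb_nonneg one_lt_two hs'
    have := logb_nonneg one_lt_two hn'
    positivity
  by_cases hB : 2 ≤ s * s * n
  · have hbase : base s n = s * s * n := max_eq_right hB
    rw [codeBound, hbase] at h
    -- The factor 4 combines the leading digit 1 of the code with the rounding of the length; it
    -- contributes 2 bits.
    have hreal : (2 : ℝ) ^ L ≤ 2 ^ 2 * ((s : ℝ) * s * n) ^ (2 * s / n) := by
      have : 2 ^ L ≤ 2 ^ 2 * (s * s * n) ^ (2 * s / n) := by omega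
      exact_mod_cast this
    have hle := logb_le_logb_of_le one_lt_two (by positivity) hreal
    rw [logb_mul (by positivity) (by positivity), logb_pow, logb_pow, logb_pow,
      logb_mul (by positivity) (by positivity), logb_mul (by positivity) (by positivity),
      logb_self_eq_one one_lt_two] at hle
    have hK : ((2 * s / n : ℕ) : ℝ) ≤ 2 * s / n := by
      have := @Nat.cast_div_le ℝ _ _ _ (2 * s) n
      simpa using this
    have := mul_le_mul_of_nonneg_right hK hlog
    calc (L : ℝ) ≤ 2 + (2 * s / n : ℕ) * (2 * logb 2 s + logb 2 n) := by
          push_cast at hle ⊢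
          linarith
      _ ≤ 2 + 2 * s / n * (2 * logb 2 s + logb 2 n) := by linarith
      _ ≤ _ := by
          rw [mul_div_right_comm (2 * (s : ℝ))]
          linarith
  -- In the remaining case `s = n = 1` the logarithms vanish and the base is 2, so `2 ^ L < 16`;
  -- this is covered by the constant 4.
  · have hs1 : s = 1 := by nlinarith
    subst hs1
    have hn1 : n = 1 := by omega
    subst hn1
    have hL : L < 4 := (Nat.pow_lt_pow_iff_right one_lt_two).1 (h.trans_le (by decide))
    have : (L : ℝ) ≤ 4 := by exact_mod_cast hL.le
    simpa using this

end PrefixComplexity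

/-! ### Transfer to the optimal machine -/

theorem mainTheorem7 {α : Type*} [Finite α] [Primcodable α] [DecidableEq α]
    (U : List Bool → ℕ →. ℕ) (hU : PrefixComplexity.IsOptimal U) :
    ∃ c : ℝ, ∀ (s n : ℕ) (t t' : List α) (S : Finset (List α)),
      1 ≤ s → 1 ≤ n → t.length = s →
      (∀ x ∈ S, x.length = n ∧ x <:+: t) →
      GreedySuperstring.IsOutput S t' →
      t'.length ≤ 2 * s →
      ((PrefixComplexity.complexity U t' (t, s, n) : ℕ∞) : ℝ≥0∞) ≤
        ENNReal.ofReal (2 * s * (2 * Real.logb 2 s + Real.logb 2 n) / n + c) := by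
  open PrefixComplexity GreedySuperstring in
  obtain ⟨c, hc⟩ := hU.optimal _ (isPrefixMachine_blockMachine (α := α))
  -- Here 4 bounds the overhead of the block code and `c` is the cost of simulating the block
  -- decoder on `U`.
  refine ⟨4 + c, fun s n t t' S hs hn ht hS hout hlen => ?_⟩
  subst ht
  have hcov : Covered t n t' :=
    hout.covered fun x hx => (hS x hx).1 ▸ covered_of_infix (hS x hx).2
  obtain ⟨L, hL, hcomp⟩ := exists_complexity_blockMachine_le hcov hs hn hlen
  have hle : complexity U t' (t, t.length, n) ≤ ((L + c : ℕ) : ℕ∞) := by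
    push_cast
    exact (hc (Encodable.encode t') (Encodable.encode (t, t.length, n))).trans
      (add_le_add_left hcomp _)
  refine (ENat.toENNReal_le.2 hle).trans ?_
  rw [ENat.toENNReal_coe, ← ENNReal.ofReal_natCast]
  refine ENNReal.ofReal_le_ofReal ?_
  push_cast
  linarith [le_of_two_pow_lt_codeBound hs hn hL]
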